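/- Let $(d_i)_{i\ge 1}$ be positive integers, $\alpha=[0;a_1,a_2,a_3,\dots]$ with $a_1=1+d_1$ and $a_i=d_i$ for $i\ge 2$, and let $q_0=1$, $q_1=a_1$, $q_m=a_mq_{m-1}+q_{m-2}$ be the denominators of the convergents to $\alpha$. For $n\ge 1$ put $\alpha_n=[0;a_{n+1},a_{n+2},\dots]$ and $\alpha_{n,1}=[0;a_{n+1}+1,a_{n+2},a_{n+3},\dots]$. For an irrational $\gamma\in(0,1)$ the characteristic Sturmian word $c_\gamma=x_0x_1x_2\cdots$ over $\{a,b\}$ is given by $x_i=a$ if $\lfloor (i+2)\gamma\rfloor=\lfloor (i+1)\gamma\rfloor$ and $x_i=b$ otherwise; "$c_\gamma$ over the alphabet $\{y,y'\}$" is the sequence obtained from $c_\gamma$ by replacing $a$ by $y$ and $b$ by $y'$. Let $$s_{-1}=b,\qquad s_0=a,\qquad s_m=s_{m-1}^{d_m}s_{m-2}\quad(m\ge1).$$ In the free group on $\{a,b\}$ let, for $m\ge -1$, $$w_m=a\,s_m\,b^{-1},\quad v_m=a\,s_{m+1}^{d_{m+2}-1}s_m\,b^{-1}\quad(m\text{ odd}),\qquad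 w_m=b\,s_m\,a^{-1},\quad v_m=b\,s_{m+1}^{d_{m+2}-1}s_m\,a^{-1}\quad(m\text{ even}),$$ and let $U_{m,j}=(w_{m-1}v_{m-2})^jw_{m-1}$ for $m\ge1$ and $j\ge-1$ (so $U_{m,-1}=v_{m-2}^{-1}$). Let $C_k(x_1\cdots x_m)=x_{k+1}\cdots x_mx_1\cdots x_k$. For a finite word $w$, write $$c_\alpha = p\,w^{(1)}z_1w^{(2)}z_2w^{(3)}z_3\cdots$$ with $p,z_1,z_2,\dots$ in the free group, to mean: $w$ has infinitely many occurrences in $c_\alpha$ and, for every $i\ge1$, the prefix of $c_\alpha$ that precedes the $i$-th occurrence of $w$ equals $p\,wz_1wz_2\cdots wz_{i-1}$. **Theorem.** Let $n\ge1$. (1) Let $w=C_k(s_n)$ with $0\le k\le q_{n-1}-2$. Then $w=u\,v_{n-2}\,v$ for words $u,v$ with $vu=w_{n-1}$ and $|v|=k+1$; the element $u\,U_{n-1,d_n-2}\,v$ is a non-empty word; and $$c_\alpha=\Bigl(\prod_{j=-1}^{n-3}v_j\Bigr)u^{-1}w^{(1)}z_1w^{(2)}z_2w^{(3)}z_3\cdots,$$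 where $z_1z_2z_3\cdots$ is $c_{\alpha_{n,1}}$ over the alphabet $\{\varepsilon,(u\,U_{n-1,d_n-2}\,v)^{-1}\}$. (2) Let $w=C_k(s_n)$ with $q_{n-1}-1\le k\le q_n-1$. Then $w=u\,w_{n-1}\,v$ for words $u,v$ with $vu=v_{n-2}$ and $|v|=k+1-q_{n-1}$; the element $v^{-1}w_nu^{-1}$ is a word; and $$c_\alpha=\Bigl(\prod_{j=-1}^{n-2}v_j\Bigr)u^{-1}w^{(1)}z_1w^{(2)}z_2w^{(3)}z_3\cdots,$$ where $z_1z_2z_3\cdots$ is $c_{\alpha_n}$ over the alphabet $\{\varepsilon,v^{-1}w_nu^{-1}\}$. -/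

import Mathlib

namespace Sturmian

/-- The two-letter alphabet. -/
inductive Letter where
  | a : Letter
  | b : Letter

open Filter Topology

noncomputable section

/-! ## Words and the free group -/

/-- A finite word, as an element of the free group on the alphabet. -/
def ofWord (w : List Letter) : FreeGroup Letter := (w.map FreeGroup.of).prod

/-- The prefix of length `m` of the infinite word `x`. -/
def wordPrefix (x : ℕ → Letter) (m : ℕ) : List Letter := (List.range m).map x

/-- The finite word `w` occurs at position `m` of the infinite word `x`. -/
def OccursAt (x : ℕ → Letter) (w : List Letter) (m : ℕ) : Prop :=
  ∀ i : Fin w.length, x (m + i) = w.get i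

/-- The decomposition `x = p w⁽¹⁾ z₁ w⁽²⁾ z₂ w⁽³⁾ z₃ ⋯` of the infinite word `x`, where `w⁽ⁱ⁾` is
the `i`-th occurrence of `w` in `x`, and where `p` and the `zᵢ` are elements of the free group (a
`zᵢ` that is the inverse of a word means that two successive occurrences overlap): the positions
at which `w` occurs in `x` form an infinite increasing sequence, and the prefix of `x` before the
`i`-th occurrence is `p w z₁ w z₂ ⋯ w zᵢ₋₁`. In the code the sequences start with index `0`. -/
def IsOccurrenceDecomposition (x : ℕ → Letter) (w : List Letter) (p : FreeGroup Letter)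
    (z : ℕ → FreeGroup Letter) : Prop :=
  ∃ pos : ℕ → ℕ, StrictMono pos ∧ Set.range pos = {m | OccursAt x w m} ∧
    ∀ i : ℕ, ofWord (wordPrefix x (pos i)) =
      p * ((List.range i).map fun j => ofWord w * z j).prod

/-- The infinite word `x` over the alphabet `{u, v}`: every letter `a` is replaced by `u` and
every letter `b` by `v`. -/
def overAlphabet (x : ℕ → Letter) (u v : FreeGroup Letter) (i : ℕ) : FreeGroup Letter :=
  match x i with
  | Letter.a => u
  | Letter.b => v

/-! ## Continued fractions -/

/-- Numerators `pₙ` of the convergents of `[0; a₁, a₂, …]` (the value `a 0` is not used). -/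
def cfNum (a : ℕ → ℕ) : ℕ → ℕ
  | 0 => 0
  | 1 => 1
  | n + 2 => a (n + 2) * cfNum a (n + 1) + cfNum a n

/-- Denominators `qₙ` of the convergents of `[0; a₁, a₂, …]`. -/
def cfDen (a : ℕ → ℕ) : ℕ → ℕ
  | 0 => 1
  | 1 => a 1
  | n + 2 => a (n + 2) * cfDen a (n + 1) + cfDen a n

/-- The value `[0; a₁, a₂, …]` of an infinite continued fraction, the limit of its convergents. -/
def cfValue (a : ℕ → ℕ) : ℝ := limUnder atTop fun n => (cfNum a n : ℝ) / (cfDen a n : ℝ)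

/-- The partial quotients of `[0; aₙ₊₁ + k, aₙ₊₂, aₙ₊₃, …]`. -/
def tailQuotients (a : ℕ → ℕ) (n k : ℕ) (i : ℕ) : ℕ :=
  if i = 1 then a (n + 1) + k else a (n + i)

/-- The number `αₙ,ₖ = [0; aₙ₊₁ + k, aₙ₊₂, aₙ₊₃, …]` attached to `α = [0; a₁, a₂, …]`. -/
def cfTail (a : ℕ → ℕ) (n k : ℕ) : ℝ := cfValue (tailQuotients a n k)

lemma cfDen_pos {a : ℕ → ℕ} (ha : ∀ i, 1 ≤ i → 1 ≤ a i) (n : ℕ) :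
    0 < cfDen a n ∧ 0 < cfDen a (n + 1) := by
  induction n with
  | zero => exact ⟨Nat.one_pos, ha 1 le_rfl⟩
  | succ n ih => exact ⟨ih.2, by rw [cfDen]; omega⟩

lemma cf_det (a : ℕ → ℕ) (n : ℕ) :
    (cfNum a (n + 1) : ℝ) * cfDen a n - cfNum a n * cfDen a (n + 1) = (-1) ^ n := by
  induction n with
  | zero => simp [cfNum, cfDen]
  | succ n ih =>
    rw [pow_succ, ← ih, cfNum, cfDen]
    push_cast
    ring

lemma two_pow_le_cfDen {a : ℕ → ℕ} (ha : ∀ i, 1 ≤ i → 1 ≤ a i) (n : ℕ) :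
    2 ^ n ≤ cfDen a n * cfDen a (n + 1) := by
  induction n with
  | zero => simpa [cfDen] using ha 1 le_rfl
  | succ n ih =>
    have h1 := ha (n + 2) (by omega)
    have h2 : cfDen a n ≤ cfDen a (n + 1) := by
      cases n with
      | zero => simpa [cfDen] using ha 1 le_rfl
      | succ m => rw [cfDen]; nlinarith [ha (m + 2) (by omega)]
    rw [pow_succ, show cfDen a (n + 1 + 1) = a (n + 2) * cfDen a (n + 1) + cfDen a n from rfl]
    nlinarith [Nat.mul_le_mul_right (cfDen a (n + 1) * cfDen a (n + 1)) h1,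
      Nat.mul_le_mul_right (cfDen a (n + 1)) h2]

/-- For positive partial quotients the limit that defines `cfValue` exists. -/
theorem tendsto_cfValue {a : ℕ → ℕ} (ha : ∀ i, 1 ≤ i → 1 ≤ a i) :
    Tendsto (fun n => (cfNum a n : ℝ) / (cfDen a n : ℝ)) atTop (𝓝 (cfValue a)) := by
  refine CauchySeq.tendsto_limUnder (cauchySeq_of_le_geometric (1 / 2) 1 (by norm_num) ?_)
  intro n
  have h1 : (0 : ℝ) < cfDen a n := by exact_mod_cast (cfDen_pos ha n).1
  have h2 : (0 : ℝ) < cfDen a (n + 1) := by exact_mod_cast (cfDen_pos ha n).2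
  have h3 : (2 : ℝ) ^ n ≤ cfDen a n * cfDen a (n + 1) := by exact_mod_cast two_pow_le_cfDen ha n
  have h4 : (cfNum a (n + 1) : ℝ) / cfDen a (n + 1) - cfNum a n / cfDen a n
      = (-1) ^ n / (cfDen a n * cfDen a (n + 1)) := by
    rw [← cf_det a n]
    field_simp
  rw [dist_comm, Real.dist_eq, h4, abs_div, abs_pow, abs_neg, abs_one, one_pow,
    abs_of_pos (mul_pos h1 h2), one_mul, one_div_pow]
  exact one_div_le_one_div_of_le (by positivity) h3

/-! ## Characteristic Sturmian words -/

/-- The word `s_{γ,ρ}` of slope `γ` and intercept `ρ`. -/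
def mechanicalWord (γ ρ : ℝ) (n : ℕ) : Letter :=
  if ⌊((n : ℝ) + 1) * γ + ρ⌋ - ⌊(n : ℝ) * γ + ρ⌋ = 0 then Letter.a else Letter.b

/-- The characteristic word `c_γ`, given by `s_{γ,0} = a c_γ`. -/
def charWord (γ : ℝ) (n : ℕ) : Letter := mechanicalWord γ 0 (n + 1)

/-! ## Standard words and singular words -/

/-- The partial quotients of `[0; 1 + d₁, d₂, d₃, …]` (the value `d 0` is not used). -/
def quotients (d : ℕ → ℕ) (i : ℕ) : ℕ := if i = 1 then 1 + d 1 else d i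

/-- The standard sequence with its index shifted by one: `stdAux d m = sₘ₋₁`. -/
def stdAux (d : ℕ → ℕ) : ℕ → List Letter
  | 0 => [Letter.b]
  | 1 => [Letter.a]
  | m + 2 => (List.replicate (d (m + 1)) (stdAux d (m + 1))).flatten ++ stdAux d m

/-- The standard words `s₋₁ = b`, `s₀ = a`, `sₙ = sₙ₋₁^{dₙ} sₙ₋₂` (used for `n ≥ -1`). -/
def std (d : ℕ → ℕ) (n : ℤ) : List Letter := stdAux d (n + 1).toNat

/-- The singular words `wₙ`, as elements of the free group: `a sₙ b⁻¹` for odd `n`, `b sₙ a⁻¹` for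
even `n`, with `w₋₂ = ε`; in particular `w₋₁ = a` (used for `n ≥ -2`). -/
def sing (d : ℕ → ℕ) (n : ℤ) : FreeGroup Letter :=
  if n = -2 then 1
  else if Odd n then FreeGroup.of Letter.a * ofWord (std d n) * (FreeGroup.of Letter.b)⁻¹
  else FreeGroup.of Letter.b * ofWord (std d n) * (FreeGroup.of Letter.a)⁻¹

/-- The adjoining singular words `vₙ`, as elements of the free group: `a sₙ₊₁^{dₙ₊₂ - 1} sₙ b⁻¹`
for odd `n`, `b sₙ₊₁^{dₙ₊₂ - 1} sₙ a⁻¹` for even `n`, with `v₋₂ = ε` (used for `n ≥ -2`). -/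
def adj (d : ℕ → ℕ) (n : ℤ) : FreeGroup Letter :=
  if n = -2 then 1
  else if Odd n then
    FreeGroup.of Letter.a * ofWord (std d (n + 1)) ^ ((d (n + 2).toNat : ℤ) - 1) *
      ofWord (std d n) * (FreeGroup.of Letter.b)⁻¹
  else
    FreeGroup.of Letter.b * ofWord (std d (n + 1)) ^ ((d (n + 2).toNat : ℤ) - 1) *
      ofWord (std d n) * (FreeGroup.of Letter.a)⁻¹

/-- The ordered product `v₋₁ v₀ ⋯ v_N` (empty for `N = -2`). -/
def adjProd (d : ℕ → ℕ) (N : ℤ) : FreeGroup Letter :=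
  ((List.range (N + 2).toNat).map fun i => adj d ((i : ℤ) - 1)).prod

/-- `U_{n,k} = (wₙ₋₁ vₙ₋₂)^k wₙ₋₁`, for `k ≥ -1`; for `k = -1` this is `vₙ₋₂⁻¹`. -/
def bigU (d : ℕ → ℕ) (n k : ℤ) : FreeGroup Letter :=
  (sing d (n - 1) * adj d (n - 2)) ^ k * sing d (n - 1)

end

end Sturmian

open Sturmian

namespace Sturmian

/-! The word `c_α` is the image of `c_{αₙ,₁}` under `a ↦ sₙ`, `b ↦ sₙ₋₁` (`isImage_stdAux`), and in
`c_{αₙ,₁}` the letter `b` is isolated. Since `sₙ sₙ₋₁` and `sₙ₋₁ sₙ` differ only in their last two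
letters (`stdAux_almost_commute`), the text from the start of a block `sₙ₋₁` imitates `sₙ` up to
those letters. Hence `C_k(sₙ)` occurs at distance `k` after every block start if `k + 2 ≤ qₙ₋₁`, and
only after the starts of blocks `sₙ` otherwise. Nothing else occurs: any other position carries
either a different conjugate of `sₙ`, the conjugates being distinct because length and number of
`b`s are coprime, or a factor with the wrong number of `b`s (`occursAt_rotate_iff`).

So the occurrences are the block starts shifted by a prefix `h` of length `k`, and the return words
are the blocks conjugated by `h` (`IsImage.isOccurrenceDecomposition`). In the first case the blocks
are `sₙ`, `sₙ₋₁`, coded by `c_{αₙ,₁}`. In the second each `sₙ` absorbs the `sₙ₋₁` that may follow,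
and the blocks `sₙ`, `sₙ sₙ₋₁` are coded by `c_{αₙ}`, because `c_{αₙ,₁}` is the image of `c_{αₙ}`
under `a ↦ a`, `b ↦ ab` (`isImage_charWord_div`). Free group identities then express `h` and the
separators by singular words (`occurrences_short`, `occurrences_long`). -/

/-! ## Images of infinite words under substitutions -/

/-- The substitution `a ↦ u`, `b ↦ v`. -/
def letterSubst (u v : List Letter) : Letter → List Letter
  | Letter.a => u
  | Letter.b => v

/-- The position at which the image of the `i`-th letter of `x` starts in the image of `x`
under the substitution `S`. -/
def blockStart (S : Letter → List Letter) (x : ℕ → Letter) (i : ℕ) : ℕ :=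
  ((wordPrefix x i).flatMap S).length

/-- The infinite word `X` is the image of `x` under the substitution `S`. -/
def IsImage (X : ℕ → Letter) (S : Letter → List Letter) (x : ℕ → Letter) : Prop :=
  ∀ i, wordPrefix X (blockStart S x i) = (wordPrefix x i).flatMap S

@[simp] lemma length_wordPrefix (x : ℕ → Letter) (m : ℕ) : (wordPrefix x m).length = m := by
  simp [wordPrefix]

lemma wordPrefix_succ (x : ℕ → Letter) (m : ℕ) :
    wordPrefix x (m + 1) = wordPrefix x m ++ [x m] := by
  simp [wordPrefix, List.range_succ]

lemma wordPrefix_add (x : ℕ → Letter) (m r : ℕ) :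
    wordPrefix x (m + r) = wordPrefix x m ++ wordPrefix (fun t => x (m + t)) r := by
  simp [wordPrefix, List.range_add]

lemma occursAt_iff (x : ℕ → Letter) (w : List Letter) (m : ℕ) :
    OccursAt x w m ↔ wordPrefix (fun t => x (m + t)) w.length = w := by
  constructor
  · intro h
    refine List.ext_get (by simp) fun i h1 h2 => ?_
    simpa [wordPrefix] using h ⟨i, h2⟩
  · intro h i
    have := congrArg (fun l : List Letter => l[i.1]?) h
    simpa [wordPrefix] using this

lemma occursAt_append (x : ℕ → Letter) (u v : List Letter) (m : ℕ) :
    OccursAt x (u ++ v) m ↔ OccursAt x u m ∧ OccursAt x v (m + u.length) := by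
  simp only [occursAt_iff, List.length_append, wordPrefix_add, add_assoc]
  exact ⟨fun h => List.append_inj h (by simp), fun h => by rw [h.1, h.2]⟩

lemma OccursAt.of_prefix {x : ℕ → Letter} {u v : List Letter} {m : ℕ} (h : OccursAt x v m)
    (huv : u <+: v) : OccursAt x u m := by
  obtain ⟨t, rfl⟩ := huv
  exact ((occursAt_append _ _ _ _).1 h).1

lemma OccursAt.eq_of_length {x : ℕ → Letter} {u v : List Letter} {m : ℕ} (hu : OccursAt x u m)
    (hv : OccursAt x v m) (h : u.length = v.length) : u = v := by
  rw [occursAt_iff] at hu hv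
  rw [← hu, ← hv, h]

lemma OccursAt.wordPrefix_add {x : ℕ → Letter} {u : List Letter} {m : ℕ} (h : OccursAt x u m) :
    wordPrefix x (m + u.length) = wordPrefix x m ++ u := by
  rw [Sturmian.wordPrefix_add, (occursAt_iff _ _ _).1 h]

@[simp] lemma blockStart_zero (S : Letter → List Letter) (x : ℕ → Letter) :
    blockStart S x 0 = 0 := by
  simp [blockStart, wordPrefix]

lemma blockStart_succ (S : Letter → List Letter) (x : ℕ → Letter) (i : ℕ) :
    blockStart S x (i + 1) = blockStart S x i + (S (x i)).length := by
  simp [blockStart, wordPrefix_succ]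

lemma isImage_iff {X : ℕ → Letter} {S : Letter → List Letter} {x : ℕ → Letter} :
    IsImage X S x ↔ ∀ i, OccursAt X (S (x i)) (blockStart S x i) := by
  constructor
  · intro h i
    have h1 := h (i + 1)
    rw [blockStart_succ, wordPrefix_add, h i, wordPrefix_succ, List.flatMap_append,
      List.append_cancel_left_eq] at h1
    rw [occursAt_iff, h1]
    simp
  · intro h i
    induction i with
    | zero => simp [wordPrefix]
    | succ i ih =>
      rw [blockStart_succ, (h i).wordPrefix_add, ih, wordPrefix_succ, List.flatMap_append]
      simp

lemma IsImage.occursAt {X : ℕ → Letter} {S : Letter → List Letter} {x : ℕ → Letter}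
    (h : IsImage X S x) (i : ℕ) : OccursAt X (S (x i)) (blockStart S x i) :=
  isImage_iff.1 h i

lemma IsImage.occursAt_append {X : ℕ → Letter} {S : Letter → List Letter} {x : ℕ → Letter}
    (h : IsImage X S x) (i : ℕ) :
    OccursAt X (S (x i) ++ S (x (i + 1))) (blockStart S x i) := by
  rw [Sturmian.occursAt_append, ← blockStart_succ]
  exact ⟨h.occursAt i, h.occursAt (i + 1)⟩

lemma blockStart_flatMap {x y : ℕ → Letter} {S T : Letter → List Letter} (h : IsImage x T y)
    (i : ℕ) :
    blockStart (fun l => (T l).flatMap S) y i = blockStart S x (blockStart T y i) := by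
  rw [blockStart, blockStart, h i, List.flatMap_assoc]

lemma IsImage.comp {X x y : ℕ → Letter} {S T : Letter → List Letter} (hX : IsImage X S x)
    (hx : IsImage x T y) : IsImage X (fun l => (T l).flatMap S) y := fun i => by
  rw [blockStart_flatMap hx, hX, hx, List.flatMap_assoc]

lemma isImage_id (x : ℕ → Letter) : IsImage x (fun l => [l]) x := fun i => by
  simp [blockStart]

lemma blockStart_strictMono {S : Letter → List Letter} (hS : ∀ l, S l ≠ []) (x : ℕ → Letter) :
    StrictMono (blockStart S x) :=
  strictMono_nat_of_lt_succ fun i => by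
    have := List.length_pos_iff.2 (hS (x i))
    rw [blockStart_succ]
    omega

lemma exists_eq_blockStart_add {S : Letter → List Letter} (hS : ∀ l, S l ≠ []) (x : ℕ → Letter)
    (m : ℕ) : ∃ i r, r < (S (x i)).length ∧ m = blockStart S x i + r := by
  induction m with
  | zero => exact ⟨0, 0, List.length_pos_iff.2 (hS _), by simp⟩
  | succ m ih =>
    obtain ⟨i, r, hr, rfl⟩ := ih
    rcases Nat.lt_or_ge (r + 1) (S (x i)).length with h | h
    · exact ⟨i, r + 1, h, rfl⟩
    · refine ⟨i + 1, 0, List.length_pos_iff.2 (hS _), ?_⟩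
      rw [blockStart_succ]
      omega

/-! ## Words in the free group -/

@[simp] lemma ofWord_nil : ofWord [] = 1 := rfl

@[simp] lemma ofWord_singleton (l : Letter) : ofWord [l] = FreeGroup.of l := by
  simp [ofWord]

@[simp] lemma ofWord_cons (l : Letter) (u : List Letter) :
    ofWord (l :: u) = FreeGroup.of l * ofWord u := by
  simp [ofWord]

@[simp] lemma ofWord_append (u v : List Letter) : ofWord (u ++ v) = ofWord u * ofWord v := by
  simp [ofWord]

@[simp] lemma ofWord_flatten_replicate (n : ℕ) (u : List Letter) :
    ofWord (List.replicate n u).flatten = ofWord u ^ n := by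
  induction n with
  | zero => simp
  | succ n ih => simp [List.replicate_succ, ih, pow_succ']

lemma ofWord_rotate {s : List Letter} {k : ℕ} (hk : k ≤ s.length) :
    ofWord (s.rotate k) = (ofWord (s.take k))⁻¹ * ofWord s * ofWord (s.take k) := by
  conv_rhs => rw [← List.take_append_drop k s]
  rw [List.rotate_eq_drop_append_take hk, ofWord_append, ofWord_append,
    List.take_append_drop, inv_mul_cancel_left]

lemma ofWord_flatMap_wordPrefix (S : Letter → List Letter) (x : ℕ → Letter) (i : ℕ) :
    ofWord ((wordPrefix x i).flatMap S) = ((List.range i).map fun j => ofWord (S (x j))).prod := by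
  induction i with
  | zero => simp [wordPrefix]
  | succ i ih => simp [wordPrefix_succ, List.range_succ, ih]

/-- If the occurrences of `w` in the image of `x` under `S` are exactly the positions at distance
`|h|` after the starts of the blocks, and `h` is a prefix of every tail that starts with a block,
then the return words of `w` are the conjugates of the blocks by `h`. -/
theorem IsImage.isOccurrenceDecomposition {X x : ℕ → Letter} {S : Letter → List Letter}
    (hX : IsImage X S x) (hS : ∀ l, S l ≠ []) {w h : List Letter} {p : FreeGroup Letter}
    {z : ℕ → FreeGroup Letter} (hh : ∀ i, OccursAt X h (blockStart S x i))
    (hocc : ∀ m, OccursAt X w m ↔ ∃ i, m = blockStart S x i + h.length)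
    (hp : p = ofWord h)
    (hz : ∀ i, ofWord w * z i = (ofWord h)⁻¹ * ofWord (S (x i)) * ofWord h) :
    IsOccurrenceDecomposition X w p z := by
  refine ⟨fun i => blockStart S x i + h.length,
    fun i j hij => Nat.add_lt_add_right (blockStart_strictMono hS x hij) _, ?_, fun i => ?_⟩
  · ext m
    simp [hocc, eq_comm]
  · rw [(hh i).wordPrefix_add, hX i, ofWord_append, ofWord_flatMap_wordPrefix, hp]
    induction i with
    | zero => simp
    | succ i ih =>
      simp only [List.range_succ, List.map_append, List.prod_append, List.map_cons, List.map_nil,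
        List.prod_cons, List.prod_nil, mul_one, ← mul_assoc] at ih ⊢
      rw [← ih, mul_assoc _ (ofWord w), hz]
      group

/-! ## Conjugates of primitive words -/

/-- The number of letters `b`, for a single letter. -/
def Letter.weight : Letter → ℕ
  | Letter.a => 0
  | Letter.b => 1

/-- The number of letters `b` in a word. -/
def bCount (w : List Letter) : ℕ := (w.map Letter.weight).sum

@[simp] lemma bCount_nil : bCount [] = 0 := rfl

@[simp] lemma bCount_append (u v : List Letter) : bCount (u ++ v) = bCount u + bCount v := by
  simp [bCount]

@[simp] lemma bCount_cons (l : Letter) (u : List Letter) :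
    bCount (l :: u) = l.weight + bCount u := by
  simp [bCount]

@[simp] lemma bCount_flatten_replicate (n : ℕ) (u : List Letter) :
    bCount (List.replicate n u).flatten = n * bCount u := by
  induction n with
  | zero => simp
  | succ n ih => simp [List.replicate_succ, ih]; ring

lemma bCount_rotate (u : List Letter) (k : ℕ) : bCount (u.rotate k) = bCount u :=
  ((List.rotate_perm u k).map _).sum_eq

lemma weight_injective : Function.Injective Letter.weight := by
  rintro (_ | _) (_ | _) h <;> simp_all [Letter.weight]

lemma sum_range_mul_of_periodic {f : ℕ → ℕ} {c : ℕ} (hf : Function.Periodic f c) (n : ℕ) :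
    ∑ i ∈ Finset.range (n * c), f i = n * ∑ i ∈ Finset.range c, f i := by
  induction n with
  | zero => simp
  | succ n ih =>
    rw [Nat.succ_mul, Finset.sum_range_add, ih, Nat.succ_mul]
    congr 1
    refine Finset.sum_congr rfl fun i _ => ?_
    rw [add_comm]
    exact hf.nat_mul n i

/-- The weights of the letters, repeated cyclically, have both periods `s.length` and `j`. Summing
them over `j * s.length` indices in two ways shows that `s.length` divides `j * bCount s`. -/
lemma dvd_of_rotate_eq_self {s : List Letter} (hs : Nat.Coprime (bCount s) s.length) {j : ℕ}
    (h : s.rotate j = s) : s.length ∣ j := by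
  rcases Nat.eq_zero_or_pos s.length with h0 | hpos
  · rw [List.length_eq_zero_iff] at h0
    subst h0
    simp at hs
  let f : ℕ → ℕ := fun i => (s[i % s.length]'(Nat.mod_lt _ hpos)).weight
  have hq : Function.Periodic f s.length := fun i => by simp [f]
  have hj : Function.Periodic f j := fun i => by
    have h1 := List.getElem_rotate s j (i % s.length) (by simpa using Nat.mod_lt _ hpos)
    simp only [h, Nat.mod_add_mod] at h1
    simp only [f, h1]
  have hsum : ∑ i ∈ Finset.range s.length, f i = bCount s := by
    rw [bCount, Finset.sum_range, ← List.sum_ofFn]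
    congr 1
    refine List.ext_getElem (by simp) fun i h1 h2 => ?_
    have : i < s.length := by simpa using h2
    simp [f, Nat.mod_eq_of_lt this]
  have h1 := sum_range_mul_of_periodic hq j
  rw [mul_comm, sum_range_mul_of_periodic hj, hsum] at h1
  exact hs.symm.dvd_of_dvd_mul_right ⟨_, h1.symm⟩

lemma rotate_injOn {s : List Letter} (hs : Nat.Coprime (bCount s) s.length) {i j : ℕ}
    (hi : i < s.length) (hj : j < s.length) (h : s.rotate i = s.rotate j) : i = j := by
  wlog hij : i ≤ j generalizing i j
  · exact (this hj hi h.symm (by omega)).symm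
  obtain ⟨r, rfl⟩ := Nat.exists_eq_add_of_le hij
  have h1 : s.rotate r = s := List.rotate_injective i <| by
    simp only [List.rotate_rotate]
    rw [add_comm, h]
  have := Nat.eq_zero_of_dvd_of_lt (dvd_of_rotate_eq_self hs h1) (by omega)
  omega

/-! ## Occurrences of the conjugates of a standard word -/

section Occurrences

variable {X x : ℕ → Letter} {s t P : List Letter} {y z : Letter}

/-- As `t` is non-empty, `P` has length at least `s.length - 1`. -/
lemma take_prefix_of_almost_commute (hst : s ++ t = P ++ [y, z]) (ht : t ≠ []) {k : ℕ}
    (hk : k < s.length) : s.take k <+: P := by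
  have hlen := congrArg List.length hst
  have := List.length_pos_iff.2 ht
  simp at hlen
  have h1 : s.take k <+: P ++ [y, z] := hst ▸ (List.take_prefix k s).trans (List.prefix_append s t)
  exact List.prefix_of_prefix_length_le h1 (List.prefix_append _ _) (by simp; omega)

lemma append_take_prefix_of_almost_commute (hst : s ++ t = P ++ [y, z]) (hts : t <+: s) {k : ℕ}
    (hk : k + 2 ≤ t.length) : s ++ s.take k <+: P := by
  have hlen := congrArg List.length hst
  simp at hlen
  have h2 : s.take k = t.take k := by
    obtain ⟨r, rfl⟩ := hts
    exact List.take_append_of_le_length (by omega)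
  have h1 : s ++ s.take k <+: P ++ [y, z] := by
    rw [← hst, h2, List.prefix_append_right_inj]
    exact List.take_prefix _ _
  exact List.prefix_of_prefix_length_le h1 (List.prefix_append _ _) (by simp; omega)

lemma letterSubst_ne_nil (hs : s ≠ []) (ht : t ≠ []) (l : Letter) : letterSubst s t l ≠ [] := by
  cases l <;> assumption

/-- After a block `s` comes either another `s` or `t ++ s`, and the latter starts with `P`. A block
`t` is followed by `s`, so the text there starts with `P`, which contains `s ++ s.take k` when `k`
is small. -/
lemma occursAt_append_take (hX : IsImage X (letterSubst s t) x)
    (hbb : ∀ i, x i = Letter.b → x (i + 1) = Letter.a)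
    (hst : s ++ t = P ++ [y, z]) (hts' : t ++ s = P ++ [z, y]) (hts : t <+: s) (ht : t ≠ [])
    {k : ℕ} (hk : k < s.length) {i : ℕ} (hi : x i = Letter.a ∨ k + 2 ≤ t.length) :
    OccursAt X (s ++ s.take k) (blockStart (letterSubst s t) x i) := by
  have key : ∀ j, x j = Letter.b → OccursAt X P (blockStart (letterSubst s t) x j) := by
    intro j hj
    have := hX.occursAt_append j
    rw [hj, hbb j hj] at this
    exact this.of_prefix (show P <+: t ++ s from hts' ▸ List.prefix_append _ _)
  cases hxi : x i with
  | a =>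
    have h1 := hX.occursAt i
    rw [occursAt_append]
    rw [hxi] at h1
    refine ⟨h1, ?_⟩
    have h2 : blockStart (letterSubst s t) x i + s.length
        = blockStart (letterSubst s t) x (i + 1) := by
      rw [blockStart_succ, hxi]; rfl
    rw [h2]
    cases hxi' : x (i + 1) with
    | a =>
      have h3 := hX.occursAt (i + 1)
      rw [hxi'] at h3
      exact h3.of_prefix (List.take_prefix _ _)
    | b => exact (key _ hxi').of_prefix (take_prefix_of_almost_commute hst ht hk)
  | b =>
    have hk2 : k + 2 ≤ t.length := by simpa [hxi] using hi
    exact (key i hxi).of_prefix (append_take_prefix_of_almost_commute hst hts hk2)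

lemma append_take_eq_take_append_rotate {k : ℕ} (hk : k ≤ s.length) :
    s ++ s.take k = s.take k ++ s.rotate k := by
  rw [List.rotate_eq_drop_append_take hk, ← List.append_assoc, List.take_append_drop]

lemma occursAt_take (hX : IsImage X (letterSubst s t) x)
    (hbb : ∀ i, x i = Letter.b → x (i + 1) = Letter.a)
    (hst : s ++ t = P ++ [y, z]) (hts' : t ++ s = P ++ [z, y]) (hts : t <+: s) (ht : t ≠ [])
    {k : ℕ} (hk : k < s.length) {i : ℕ} (hi : x i = Letter.a ∨ k + 2 ≤ t.length) :
    OccursAt X (s.take k) (blockStart (letterSubst s t) x i) :=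
  (occursAt_append_take hX hbb hst hts' hts ht hk hi).of_prefix
    ((List.take_prefix _ _).trans (List.prefix_append _ _))

lemma occursAt_rotate (hX : IsImage X (letterSubst s t) x)
    (hbb : ∀ i, x i = Letter.b → x (i + 1) = Letter.a)
    (hst : s ++ t = P ++ [y, z]) (hts' : t ++ s = P ++ [z, y]) (hts : t <+: s) (ht : t ≠ [])
    {k : ℕ} (hk : k < s.length) {i : ℕ} (hi : x i = Letter.a ∨ k + 2 ≤ t.length) :
    OccursAt X (s.rotate k) (blockStart (letterSubst s t) x i + k) := by
  have h := occursAt_append_take hX hbb hst hts' hts ht hk hi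
  rw [append_take_eq_take_append_rotate hk.le, occursAt_append, List.length_take,
    min_eq_left hk.le] at h
  exact h.2

/-- At an offset `r` in a block the text shows `s.rotate r`, unless `r` is the last position of a
block `t`; primitivity then forces `r = k`. -/
theorem occursAt_rotate_iff (hX : IsImage X (letterSubst s t) x)
    (hbb : ∀ i, x i = Letter.b → x (i + 1) = Letter.a)
    (hst : s ++ t = P ++ [y, z]) (hts' : t ++ s = P ++ [z, y]) (hyz : y ≠ z)
    (hts : t <+: s) (ht : t ≠ []) (hcop : Nat.Coprime (bCount s) s.length)
    {k : ℕ} (hk : k < s.length) (m : ℕ) :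
    OccursAt X (s.rotate k) m ↔ ∃ i, m = blockStart (letterSubst s t) x i + k ∧
      (x i = Letter.a ∨ k + 2 ≤ t.length) := by
  refine ⟨fun h => ?_, ?_⟩
  · have hs0 : s ≠ [] := by rintro rfl; simp at hk
    obtain ⟨i, r, hr, rfl⟩ := exists_eq_blockStart_add (letterSubst_ne_nil hs0 ht) x m
    by_cases hgood : r < s.length ∧ (x i = Letter.a ∨ r + 2 ≤ t.length)
    · have h1 := occursAt_rotate hX hbb hst hts' hts ht hgood.1 hgood.2
      have : r = k := rotate_injOn hcop hgood.1 hk (h1.eq_of_length h (by simp))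
      subst this
      exact ⟨i, rfl, hgood.2⟩
    · exfalso
      have hxi : x i = Letter.b := by
        cases hxi : x i
        · rw [hxi] at hr
          exact absurd ⟨hr, Or.inl hxi⟩ hgood
        · rfl
      rw [hxi] at hr
      change r < t.length at hr
      have hle := hts.length_le
      have hr' : r + 1 = t.length := by
        by_contra hne
        exact hgood ⟨by omega, Or.inr (by omega)⟩
      -- Only the last letter of a block `t` is left. The two factorizations identify the last
      -- letter of `t` as `z` and that of `s` as `y`.
      obtain ⟨t', z', rfl⟩ := List.eq_nil_or_concat t |>.resolve_left ht
      obtain ⟨s', y', rfl⟩ := List.eq_nil_or_concat s |>.resolve_left hs0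
      simp only [List.concat_eq_append] at *
      have hz : z' = z := by
        have := congrArg List.getLast? (hst.trans (List.append_cons P y [z]))
        rwa [← List.append_assoc, List.getLast?_concat, List.getLast?_concat,
          Option.some_inj] at this
      have hy : y' = y := by
        have := congrArg List.getLast? (hts'.trans (List.append_cons P z [y]))
        rwa [← List.append_assoc, List.getLast?_concat, List.getLast?_concat,
          Option.some_inj] at this
      subst hz hy
      have hlen : t'.length = r := by simpa using hr'.symm
      have h2 := hX.occursAt_append i
      rw [hxi, hbb i hxi] at h2
      change OccursAt X ((t' ++ [z']) ++ (s' ++ [y'])) _ at h2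
      -- The factor of length `|s|` at this position is `z' :: s'`, whereas `s = s' ++ [y']`. A
      -- rotation preserves the number of `b`s, which contradicts `y ≠ z`.
      rw [show (t' ++ [z']) ++ (s' ++ [y']) = t' ++ ((z' :: s') ++ [y']) by simp,
        occursAt_append, hlen] at h2
      have h3 := (h2.2.of_prefix (List.prefix_append _ _)).eq_of_length h (by simp)
      have h4 := congrArg bCount h3
      rw [bCount_rotate] at h4
      simp only [bCount_cons, bCount_append, bCount_nil] at h4
      exact hyz (weight_injective (by omega))
  · rintro ⟨i, rfl, hi⟩
    exact occursAt_rotate hX hbb hst hts' hts ht hk hi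

end Occurrences

/-! ## Continued fractions -/

lemma cfValue_congr {a b : ℕ → ℕ} (h : ∀ i, 1 ≤ i → a i = b i) : cfValue a = cfValue b := by
  have hN : ∀ n, cfNum a n = cfNum b n ∧ cfNum a (n + 1) = cfNum b (n + 1) := by
    intro n
    induction n with
    | zero => exact ⟨rfl, rfl⟩
    | succ n ih => exact ⟨ih.2, by rw [cfNum, cfNum, ih.1, ih.2, h _ (by omega)]⟩
  have hD : ∀ n, cfDen a n = cfDen b n ∧ cfDen a (n + 1) = cfDen b (n + 1) := by
    intro n
    induction n with
    | zero => exact ⟨rfl, h 1 le_rfl⟩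
    | succ n ih => exact ⟨ih.2, by rw [cfDen, cfDen, ih.1, ih.2, h _ (by omega)]⟩
  simp only [cfValue, (hN _).1, (hD _).1]

lemma cfNum_succ (a : ℕ → ℕ) (n : ℕ) : cfNum a (n + 1) = cfDen (fun i => a (i + 1)) n := by
  induction n using Nat.twoStepInduction with
  | zero => rfl
  | one => simp [cfNum, cfDen]
  | more n h1 h2 => rw [cfNum, cfDen, h1, h2]

lemma cfDen_succ (a : ℕ → ℕ) (n : ℕ) :
    cfDen a (n + 1) = a 1 * cfDen (fun i => a (i + 1)) n + cfNum (fun i => a (i + 1)) n := by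
  induction n using Nat.twoStepInduction with
  | zero => simp [cfNum, cfDen]
  | one => simp [cfNum, cfDen]; ring
  | more n h1 h2 => rw [cfDen, h1, h2, cfDen, cfNum]; ring

open Filter Topology in
lemma cfValue_nonneg {a : ℕ → ℕ} (ha : ∀ i, 1 ≤ i → 1 ≤ a i) : 0 ≤ cfValue a :=
  ge_of_tendsto' (tendsto_cfValue ha) fun n => by positivity

-- Each convergent satisfies the finite form of this identity (`cfNum_succ`, `cfDen_succ`); pass to
-- the limit.
open Filter Topology in
lemma cfValue_eq {a : ℕ → ℕ} (ha : ∀ i, 1 ≤ i → 1 ≤ a i) :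
    cfValue a = 1 / (a 1 + cfValue fun i => a (i + 1)) := by
  have ha' : ∀ i, 1 ≤ i → 1 ≤ a (i + 1) := fun i _ => ha _ (by omega)
  have h1 : (1 : ℝ) ≤ a 1 := by exact_mod_cast ha 1 le_rfl
  have h0 := cfValue_nonneg ha'
  have hlim : Tendsto (fun n => (cfNum a (n + 1) : ℝ) / cfDen a (n + 1)) atTop
      (𝓝 (1 / (a 1 + cfValue fun i => a (i + 1)))) := by
    refine (tendsto_const_nhds.div (tendsto_const_nhds.add (tendsto_cfValue ha'))
      (by positivity)).congr fun n => ?_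
    have hq : (0 : ℝ) < cfDen (fun i => a (i + 1)) n := by exact_mod_cast (cfDen_pos ha' n).1
    rw [cfNum_succ, cfDen_succ]
    simp only [Pi.div_apply]
    push_cast
    field_simp
  exact tendsto_nhds_unique ((tendsto_add_atTop_iff_nat 1).2 (tendsto_cfValue ha)) hlim

lemma cfValue_pos {a : ℕ → ℕ} (ha : ∀ i, 1 ≤ i → 1 ≤ a i) : 0 < cfValue a := by
  have h0 := cfValue_nonneg fun i (_ : 1 ≤ i) => ha (i + 1) (by omega)
  have h1 : (1 : ℝ) ≤ a 1 := by exact_mod_cast ha 1 le_rfl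
  rw [cfValue_eq ha]
  positivity

lemma cfValue_lt_one {a : ℕ → ℕ} (ha : ∀ i, 1 ≤ i → 1 ≤ a i) : cfValue a < 1 := by
  have h0 := cfValue_pos fun i (_ : 1 ≤ i) => ha (i + 1) (by omega)
  have h1 : (1 : ℝ) ≤ a 1 := by exact_mod_cast ha 1 le_rfl
  rw [cfValue_eq ha, div_lt_one (by positivity)]
  linarith

lemma irrational_cfValue {a : ℕ → ℕ} (ha : ∀ i, 1 ≤ i → 1 ≤ a i) : Irrational (cfValue a) := by
  have key : ∀ (q : ℕ) (a : ℕ → ℕ), (∀ i, 1 ≤ i → 1 ≤ a i) → 0 < q →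
      ∀ p : ℤ, cfValue a * q ≠ p := by
    intro q
    induction q using Nat.strong_induction_on with
    | _ q ih =>
      intro a ha hq p hp
      have ha' : ∀ i, 1 ≤ i → 1 ≤ a (i + 1) := fun i _ => ha _ (by omega)
      have hq' : (0 : ℝ) < q := by exact_mod_cast hq
      have hpos := cfValue_pos ha
      have hlt := cfValue_lt_one ha
      have hp0 : (0 : ℝ) < p := by rw [← hp]; positivity
      have hp1 : (p : ℝ) < q := by rw [← hp]; nlinarith
      obtain ⟨r, rfl⟩ := Int.eq_ofNat_of_zero_le (show 0 ≤ p by exact_mod_cast hp0.le)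
      -- Descent: if the value is `r / q`, then its tail is `(q - a₁ r) / r`, with denominator `r <
      -- q`.
      refine ih r (by exact_mod_cast hp1) _ ha' (by exact_mod_cast hp0) ((q : ℤ) - a 1 * r) ?_
      have h0 := cfValue_pos ha'
      have h1 : (1 : ℝ) ≤ a 1 := by exact_mod_cast ha 1 le_rfl
      rw [cfValue_eq ha, div_mul_eq_mul_div, div_eq_iff (by positivity)] at hp
      push_cast at hp ⊢
      linarith
  rintro ⟨r, hr⟩
  refine key r.den a ha r.den_pos r.num ?_
  rw [← hr]
  exact_mod_cast r.mul_den_eq_num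

/-! ## Characteristic words under elementary substitutions -/

lemma charWord_eq (γ : ℝ) (i : ℕ) : charWord γ i =
    if ⌊((i + 2 : ℕ) : ℝ) * γ⌋ = ⌊((i + 1 : ℕ) : ℝ) * γ⌋ then Letter.a else Letter.b := by
  simp only [charWord, mechanicalWord, add_zero, sub_eq_zero]
  push_cast
  rw [show (i : ℝ) + 1 + 1 = i + 2 by ring]

lemma floor_succ_mul {γ : ℝ} (h0 : 0 < γ) (h1 : γ < 1) (m : ℕ) :
    ⌊((m + 1 : ℕ) : ℝ) * γ⌋ = ⌊(m : ℝ) * γ⌋ ∨ ⌊((m + 1 : ℕ) : ℝ) * γ⌋ = ⌊(m : ℝ) * γ⌋ + 1 := by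
  have h2 := Int.floor_le ((m : ℝ) * γ)
  have h3 := Int.lt_floor_add_one ((m : ℝ) * γ)
  by_cases h : ((m + 1 : ℕ) : ℝ) * γ < ⌊(m : ℝ) * γ⌋ + 1
  · left
    rw [Int.floor_eq_iff]
    push_cast at h ⊢
    constructor <;> linarith
  · right
    rw [Int.floor_eq_iff]
    push_cast at h ⊢
    constructor <;> linarith

lemma floor_nat_mul_lt {γ : ℝ} (hγ : Irrational γ) {m : ℕ} (hm : m ≠ 0) :
    (⌊(m : ℝ) * γ⌋ : ℝ) < m * γ :=
  lt_of_le_of_ne (Int.floor_le _) fun h => (hγ.natCast_mul hm).ne_int _ h.symm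

/-- The exchange of the two letters. -/
def Letter.swap : Letter → Letter
  | Letter.a => Letter.b
  | Letter.b => Letter.a

/-- For irrational `γ` and `m ≠ 0` the number `mγ` is not an integer, so the floors for `γ` and `1 -
γ` add up to `m - 1`, and an increment of one is a non-increment of the other. -/
lemma charWord_one_sub {γ : ℝ} (hγ : Irrational γ) (h0 : 0 < γ) (h1 : γ < 1) (i : ℕ) :
    charWord (1 - γ) i = (charWord γ i).swap := by
  have key : ∀ m : ℕ, m ≠ 0 → ⌊(m : ℝ) * (1 - γ)⌋ = m - ⌊(m : ℝ) * γ⌋ - 1 := by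
    intro m hm
    have h2 := floor_nat_mul_lt hγ hm
    have h3 := Int.lt_floor_add_one ((m : ℝ) * γ)
    rw [Int.floor_eq_iff]
    push_cast
    constructor <;> linarith
  rw [charWord_eq, charWord_eq, key _ (by omega), key _ (by omega)]
  rcases floor_succ_mul h0 h1 (i + 1) with h | h <;> rw [h] <;> push_cast
  · rw [if_neg (by omega), if_pos rfl]; rfl
  · rw [if_pos (by omega), if_neg (by omega)]; rfl

lemma isImage_charWord_one_sub {γ : ℝ} (hγ : Irrational γ) (h0 : 0 < γ) (h1 : γ < 1) :
    IsImage (charWord (1 - γ)) (letterSubst [Letter.b] [Letter.a]) (charWord γ) := by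
  have hstart : ∀ i, blockStart (letterSubst [Letter.b] [Letter.a]) (charWord γ) i = i := by
    intro i
    induction i with
    | zero => simp
    | succ i ih =>
      rw [blockStart_succ, ih]
      cases charWord γ i <;> rfl
  rw [isImage_iff]
  intro i
  have h : letterSubst [Letter.b] [Letter.a] (charWord γ i) = [charWord (1 - γ) i] := by
    rw [charWord_one_sub hγ h0 h1]
    cases charWord γ i <;> rfl
  rw [hstart, h]
  simp [OccursAt]

/-- With `f = ⌊iγ⌋` and denominators cleared, the lower bound at `N` is `f ≤ iγ` and the upper bound
at `N + 1` is `iγ < f + 1`. -/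
lemma floor_beatty {γ : ℝ} (h0 : 0 < γ) (h1 : γ < 1) {i N : ℕ}
    (hN : (N : ℤ) = i + ⌊(i : ℝ) * γ⌋) :
    ⌊(N : ℝ) * (γ / (1 + γ))⌋ = ⌊(i : ℝ) * γ⌋ ∧
      ⌊((N + 1 : ℕ) : ℝ) * (γ / (1 + γ))⌋ = ⌊(i : ℝ) * γ⌋ := by
  have h2 := Int.floor_le ((i : ℝ) * γ)
  have h3 := Int.lt_floor_add_one ((i : ℝ) * γ)
  have hN' : (N : ℝ) = i + ⌊(i : ℝ) * γ⌋ := by exact_mod_cast hN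
  generalize (⌊(i : ℝ) * γ⌋) = f at *
  have hγ : (0 : ℝ) < 1 + γ := by linarith
  simp only [Int.floor_eq_iff, ← mul_div_assoc]
  push_cast
  rw [le_div_iff₀ hγ, div_lt_iff₀ hγ, le_div_iff₀ hγ, div_lt_iff₀ hγ, hN']
  refine ⟨⟨?_, ?_⟩, ?_, ?_⟩ <;> nlinarith

lemma isImage_charWord_div {γ : ℝ} (h0 : 0 < γ) (h1 : γ < 1) :
    IsImage (charWord (γ / (1 + γ))) (letterSubst [Letter.a] [Letter.a, Letter.b])
      (charWord γ) := by
  -- A block has length one plus the increment of `⌊(i + 1)γ⌋`, so the lengths telescope.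
  have hstart : ∀ i, (blockStart (letterSubst [Letter.a] [Letter.a, Letter.b]) (charWord γ) i : ℤ)
      = i + ⌊((i + 1 : ℕ) : ℝ) * γ⌋ := by
    intro i
    induction i with
    | zero => simpa using (Int.floor_eq_zero_iff.2 ⟨h0.le, h1⟩).symm
    | succ i ih =>
      rw [blockStart_succ, charWord_eq]
      rcases floor_succ_mul h0 h1 (i + 1) with h | h
      · rw [if_pos h, h]
        push_cast [letterSubst] at ih ⊢
        simp only [List.length_cons, List.length_nil]
        push_cast
        rw [ih]; ring
      · rw [if_neg (by rw [h]; omega), h]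
        push_cast [letterSubst] at ih ⊢
        simp only [List.length_cons, List.length_nil]
        push_cast
        rw [ih]; ring
  rw [isImage_iff]
  intro i
  have hs := hstart i
  have hs' := hstart (i + 1)
  rw [blockStart_succ] at hs'
  generalize blockStart (letterSubst [Letter.a] [Letter.a, Letter.b]) (charWord γ) i = N at *
  -- Letter `N` compares the floors at `N + 1` and `N + 2`; hence the shift by one before
  -- `floor_beatty` applies.
  have hN : ((N + 1 : ℕ) : ℤ) = ((i + 1 : ℕ) : ℤ) + ⌊((i + 1 : ℕ) : ℝ) * γ⌋ := by
    push_cast at hs ⊢; linarith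
  have hb := floor_beatty h0 h1 hN
  have ha : charWord (γ / (1 + γ)) N = Letter.a := by
    rw [charWord_eq, if_pos]
    rw [hb.1, ← hb.2]
  cases hx : charWord γ i with
  | a => intro j; fin_cases j; simpa [letterSubst] using ha
  | b =>
    have hbl : charWord (γ / (1 + γ)) (N + 1) = Letter.b := by
      rw [hx] at hs'
      -- The next block starts at `N + 2`, so the floors at `N + 2` and `N + 3` are `⌊(i + 1)γ⌋` and
      -- `⌊(i + 2)γ⌋`, which differ because letter `i` is `b`.
      have hN' : ((N + 3 : ℕ) : ℤ) = ((i + 2 : ℕ) : ℤ) + ⌊((i + 2 : ℕ) : ℝ) * γ⌋ := by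
        simp only [letterSubst, List.length_cons, List.length_nil] at hs'
        push_cast at hs' ⊢
        rw [show (i : ℝ) + 1 + 1 = i + 2 by ring] at hs'
        linarith
      have hb' := floor_beatty h0 h1 hN'
      rw [charWord_eq] at hx ⊢
      rw [if_neg]
      rw [show N + 1 + 2 = N + 3 from rfl, show N + 1 + 1 = N + 1 + 1 from rfl, hb'.1, hb.2]
      intro h
      rw [if_pos h] at hx
      cases hx
    intro j
    fin_cases j
    · simpa [letterSubst] using ha
    · simpa [letterSubst] using hbl

lemma irrational_one_div_add {β : ℝ} (hβ : Irrational β) (d : ℕ) : Irrational (1 / (d + 1 / β)) := by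
  simpa using (hβ.inv.natCast_add d).inv

/-- The map `γ ↦ γ / (1 + γ)` adds one to `1 / γ`, so this is `isImage_charWord_div` iterated `d`
times. -/
lemma isImage_charWord_one_div {β : ℝ} (h0 : 0 < β) (h1 : β < 1) (d : ℕ) :
    IsImage (charWord (1 / (d + 1 / β)))
      (letterSubst [Letter.a] (List.replicate d Letter.a ++ [Letter.b])) (charWord β) := by
  induction d with
  | zero =>
    have : letterSubst [Letter.a] (List.replicate 0 Letter.a ++ [Letter.b]) = fun l => [l] := by
      funext l
      cases l <;> rfl
    rw [this]
    simpa using isImage_id (charWord β)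
  | succ d ih =>
    have hβ : 1 < 1 / β := by rwa [lt_div_iff₀ h0, one_mul]
    have hd : (0 : ℝ) ≤ d := Nat.cast_nonneg d
    have hpos : (0 : ℝ) < d + 1 / β := by linarith
    have h2 := (isImage_charWord_div (γ := 1 / (d + 1 / β)) (by positivity)
      (by rw [div_lt_one hpos]; linarith)).comp ih
    convert h2 using 1
    · congr 1
      push_cast
      field_simp
      ring
    · funext l
      cases l
      · rfl
      · simp [letterSubst, List.replicate_succ', List.flatMap_append, List.flatMap_replicate]

lemma IsImage.exists_blockStart {x y : ℕ → Letter}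
    (h : IsImage x (letterSubst [Letter.a] [Letter.a, Letter.b]) y) (i : ℕ) :
    ∃ j, (i = blockStart (letterSubst [Letter.a] [Letter.a, Letter.b]) y j ∧ x i = Letter.a) ∨
      (i + 1 = blockStart (letterSubst [Letter.a] [Letter.a, Letter.b]) y (j + 1) ∧
        x i = Letter.b) := by
  obtain ⟨j, r, hr, rfl⟩ := exists_eq_blockStart_add
    (letterSubst_ne_nil (List.cons_ne_nil Letter.a []) (List.cons_ne_nil Letter.a [Letter.b])) y i
  refine ⟨j, ?_⟩
  rw [blockStart_succ]
  have ho := h.occursAt j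
  cases hy : y j <;> rw [hy] at hr ho
  · have h0 := ho ⟨0, by simp [letterSubst]⟩
    simp only [letterSubst, List.length_cons, List.length_nil] at hr
    obtain rfl : r = 0 := by omega
    exact Or.inl ⟨rfl, h0⟩
  · simp only [letterSubst, List.length_cons, List.length_nil] at hr
    obtain rfl | rfl : r = 0 ∨ r = 1 := by omega
    · exact Or.inl ⟨rfl, ho ⟨0, by simp [letterSubst]⟩⟩
    · exact Or.inr ⟨rfl, ho ⟨1, by simp [letterSubst]⟩⟩

lemma IsImage.apply_blockStart {x y : ℕ → Letter}
    (h : IsImage x (letterSubst [Letter.a] [Letter.a, Letter.b]) y) (j : ℕ) :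
    x (blockStart (letterSubst [Letter.a] [Letter.a, Letter.b]) y j) = Letter.a := by
  have ho := h.occursAt j
  cases hy : y j <;> rw [hy] at ho
  · exact ho ⟨0, by simp [letterSubst]⟩
  · exact ho ⟨0, by simp [letterSubst]⟩

lemma IsImage.eq_a_iff {x y : ℕ → Letter}
    (h : IsImage x (letterSubst [Letter.a] [Letter.a, Letter.b]) y) (i : ℕ) :
    x i = Letter.a ↔ ∃ j, i = blockStart (letterSubst [Letter.a] [Letter.a, Letter.b]) y j := by
  refine ⟨fun hi => ?_, ?_⟩
  · obtain ⟨j, hj | hj⟩ := h.exists_blockStart i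
    · exact ⟨j, hj.1⟩
    · rw [hi] at hj
      cases hj.2
  · rintro ⟨j, rfl⟩
    exact h.apply_blockStart j

lemma IsImage.succ_eq_a {x y : ℕ → Letter}
    (h : IsImage x (letterSubst [Letter.a] [Letter.a, Letter.b]) y) {i : ℕ}
    (hi : x i = Letter.b) : x (i + 1) = Letter.a := by
  obtain ⟨j, hj | hj⟩ := h.exists_blockStart i
  · rw [hi] at hj
    cases hj.2
  · rw [hj.1]
    exact h.apply_blockStart _

/-! ## The characteristic word as an image under standard substitutions -/

/-- The number `[0; dₙ₊₁, dₙ₊₂, …]`. -/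
noncomputable def tailValue (d : ℕ → ℕ) (n : ℕ) : ℝ := cfValue fun i => d (n + i)

lemma quotients_of_two_le {d : ℕ → ℕ} {i : ℕ} (hi : 2 ≤ i) : quotients d i = d i :=
  if_neg (by omega)

section

variable {d : ℕ → ℕ} (hd : ∀ i, 1 ≤ i → 1 ≤ d i)
include hd

lemma tailValue_pos (n : ℕ) : 0 < tailValue d n := cfValue_pos fun i _ => hd (n + i) (by omega)

lemma tailValue_lt_one (n : ℕ) : tailValue d n < 1 :=
  cfValue_lt_one fun i _ => hd (n + i) (by omega)

lemma irrational_tailValue (n : ℕ) : Irrational (tailValue d n) :=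
  irrational_cfValue fun i _ => hd (n + i) (by omega)

lemma tailValue_eq (n : ℕ) : tailValue d n = 1 / (d (n + 1) + tailValue d (n + 1)) := by
  rw [tailValue, cfValue_eq fun i _ => hd (n + i) (by omega)]
  simp only [tailValue, add_assoc, add_comm 1]

/-- Raising the first quotient by one adds one to the reciprocal. This puts `α` and `αₙ,₁` in the
common form `τ / (1 + τ)`. -/
lemma cfValue_succ_eq (n : ℕ) : cfValue (fun i => if i = 1 then d (n + 1) + 1 else d (n + i)) =
    tailValue d n / (1 + tailValue d n) := by
  have h0 := tailValue_pos hd (n + 1)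
  have h1 : (1 : ℝ) ≤ d (n + 1) := by exact_mod_cast hd (n + 1) (by omega)
  rw [cfValue_eq, tailValue_eq hd n]
  · have : cfValue (fun i => if i + 1 = 1 then d (n + 1) + 1 else d (n + (i + 1)))
        = tailValue d (n + 1) := by
      refine cfValue_congr fun i hi => ?_
      rw [if_neg (by omega)]
      congr 1
      ring
    rw [this, if_pos rfl]
    push_cast
    field_simp
    ring
  · intro i hi
    split_ifs
    · omega
    · exact hd _ (by omega)

lemma cfValue_quotients : cfValue (quotients d) = tailValue d 0 / (1 + tailValue d 0) := by
  rw [← cfValue_succ_eq hd]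
  refine cfValue_congr fun i _ => ?_
  simp [quotients, add_comm]

lemma cfTail_quotients_one {n : ℕ} (hn : 1 ≤ n) :
    cfTail (quotients d) n 1 = tailValue d n / (1 + tailValue d n) := by
  rw [← cfValue_succ_eq hd, cfTail]
  refine cfValue_congr fun i hi => ?_
  rw [tailQuotients, quotients_of_two_le (by omega), quotients_of_two_le (by omega)]

omit hd in
lemma cfTail_quotients_zero {n : ℕ} (hn : 1 ≤ n) : cfTail (quotients d) n 0 = tailValue d n := by
  rw [cfTail, tailValue]
  refine cfValue_congr fun i hi => ?_
  rw [tailQuotients, quotients_of_two_le (by omega), quotients_of_two_le (by omega)]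
  split_ifs with h
  · rw [h, add_zero]
  · rfl

lemma isImage_charWord_tail (n : ℕ) :
    IsImage (charWord (tailValue d n / (1 + tailValue d n)))
      (letterSubst [Letter.a] [Letter.a, Letter.b]) (charWord (tailValue d n)) :=
  isImage_charWord_div (tailValue_pos hd n) (tailValue_lt_one hd n)

/-- With `τ = tailValue d (n + 1)` and `β = 1 - τ / (1 + τ) = 1 / (1 + τ)`, the slope on the left is
`1 / (dₙ₊₁ + 1 / β)`. Exchanging the letters turns `β` into `τ / (1 + τ)`. -/
lemma isImage_charWord_tail_succ (n : ℕ) :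
    IsImage (charWord (tailValue d n / (1 + tailValue d n)))
      (letterSubst (List.replicate (d (n + 1)) Letter.a ++ [Letter.b]) [Letter.a])
      (charWord (tailValue d (n + 1) / (1 + tailValue d (n + 1)))) := by
  have h0 := tailValue_pos hd (n + 1)
  have hirr := irrational_tailValue hd (n + 1)
  have h1 : (1 : ℝ) ≤ d (n + 1) := by exact_mod_cast hd (n + 1) (by omega)
  have heq : tailValue d n / (1 + tailValue d n) =
      1 / (d (n + 1) + 1 / (1 - tailValue d (n + 1) / (1 + tailValue d (n + 1)))) := by
    rw [tailValue_eq hd n]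
    generalize tailValue d (n + 1) = τ at *
    rw [show 1 - τ / (1 + τ) = 1 / (1 + τ) by field_simp; ring]
    field_simp
    ring
  have hirr' : Irrational (tailValue d (n + 1) / (1 + tailValue d (n + 1))) := by
    have : tailValue d (n + 1) / (1 + tailValue d (n + 1))
        = 1 / ((1 : ℕ) + 1 / tailValue d (n + 1)) := by
      push_cast
      field_simp
      ring
    rw [this]
    exact irrational_one_div_add hirr 1
  rw [heq]
  generalize tailValue d (n + 1) = τ at *
  have hγ0 : 0 < τ / (1 + τ) := by positivity
  have hγ1 : τ / (1 + τ) < 1 := by rw [div_lt_one (by positivity)]; linarith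
  have h := (isImage_charWord_one_div (β := 1 - τ / (1 + τ)) (by linarith) (by linarith)
    (d (n + 1))).comp (isImage_charWord_one_sub hirr' hγ0 hγ1)
  convert h using 1
  funext l
  cases l <;> simp [letterSubst]

/-- Composing with `a ↦ a^{dₙ₊₁} b`, `b ↦ a` replaces the pair `(sₙ, sₙ₋₁)` by `(sₙ^{dₙ₊₁} sₙ₋₁,
sₙ)`, which is the recursion of the standard words. -/
theorem isImage_stdAux (n : ℕ) :
    IsImage (charWord (tailValue d 0 / (1 + tailValue d 0)))
      (letterSubst (stdAux d (n + 1)) (stdAux d n))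
      (charWord (tailValue d n / (1 + tailValue d n))) := by
  induction n with
  | zero =>
    have : letterSubst (stdAux d (0 + 1)) (stdAux d 0) = fun l => [l] := by
      funext l
      cases l <;> rfl
    rw [this]
    exact isImage_id _
  | succ n ih =>
    convert ih.comp (isImage_charWord_tail_succ hd n) using 1
    funext l
    cases l <;> simp [letterSubst, stdAux, List.flatMap_append, List.flatMap_replicate]

end

/-! ## Standard words and singular words -/

/-- The last letter of `stdAux d m`. -/
def lastLetter (m : ℕ) : Letter := if Even m then Letter.b else Letter.a

@[simp] lemma lastLetter_add_two (m : ℕ) : lastLetter (m + 2) = lastLetter m := by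
  simp [lastLetter, Nat.even_add]

lemma lastLetter_succ_ne (m : ℕ) : lastLetter (m + 1) ≠ lastLetter m := by
  by_cases h : Even m <;> simp [lastLetter, h, Nat.even_add_one]

/-- The word `stdAux d m` without its last letter. -/
def stem (d : ℕ → ℕ) (m : ℕ) : List Letter := (stdAux d m).dropLast

lemma stdAux_eq (d : ℕ → ℕ) (m : ℕ) : stdAux d m = stem d m ++ [lastLetter m] := by
  have : ∃ t, stdAux d m = t ++ [lastLetter m] := by
    induction m using Nat.twoStepInduction with
    | zero => exact ⟨[], rfl⟩
    | one => exact ⟨[], rfl⟩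
    | more m h1 h2 =>
      obtain ⟨t, ht⟩ := h1
      exact ⟨_, by rw [stdAux, ht, lastLetter_add_two, List.append_assoc]⟩
  obtain ⟨t, ht⟩ := this
  rw [stem, ht, List.dropLast_concat]

lemma stdAux_ne_nil (d : ℕ → ℕ) (m : ℕ) : stdAux d m ≠ [] := by
  rw [stdAux_eq]
  simp

/-- Both products of the next pair start with the same power of the middle word; what remains is the
previous pair in the opposite order. -/
lemma stdAux_almost_commute (d : ℕ → ℕ) (m : ℕ) : ∃ P,
    stdAux d (m + 1) ++ stdAux d m = P ++ [lastLetter (m + 1), lastLetter m] ∧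
      stdAux d m ++ stdAux d (m + 1) = P ++ [lastLetter m, lastLetter (m + 1)] := by
  induction m with
  | zero => exact ⟨[], rfl, rfl⟩
  | succ m ih =>
    obtain ⟨P, h1, h2⟩ := ih
    refine ⟨(List.replicate (d (m + 1)) (stdAux d (m + 1))).flatten ++ P, ?_, ?_⟩
    · rw [stdAux, List.append_assoc, h2, lastLetter_add_two, List.append_assoc]
    · have hc : stdAux d (m + 1) ++ (List.replicate (d (m + 1)) (stdAux d (m + 1))).flatten
          = (List.replicate (d (m + 1)) (stdAux d (m + 1))).flatten ++ stdAux d (m + 1) := by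
        rw [← List.flatten_concat, ← List.replicate_succ', List.replicate_succ, List.flatten_cons]
      rw [stdAux, ← List.append_assoc, hc, List.append_assoc, h1, lastLetter_add_two,
        List.append_assoc]

lemma ofWord_stdAux (d : ℕ → ℕ) (m : ℕ) :
    ofWord (stdAux d (m + 2)) = ofWord (stdAux d (m + 1)) ^ d (m + 1) * ofWord (stdAux d m) := by
  simp [stdAux]

lemma ofWord_stem (d : ℕ → ℕ) (m : ℕ) :
    ofWord (stem d m) = ofWord (stdAux d m) * (FreeGroup.of (lastLetter m))⁻¹ := by
  simp [stdAux_eq d m]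

lemma length_stdAux (d : ℕ → ℕ) (m : ℕ) :
    (stdAux d (m + 1)).length = cfDen (quotients d) m := by
  induction m using Nat.twoStepInduction with
  | zero => rfl
  | one => simp [stdAux, cfDen, quotients, add_comm]
  | more m h1 h2 =>
    rw [stdAux, cfDen, List.length_append, h1, List.length_flatten, List.map_replicate,
      List.sum_replicate, h2]
    simp [quotients]

/-- The recursion changes the sign of this determinant; it serves as a Bézout relation between
length and number of `b`s. -/
lemma stdAux_det (d : ℕ → ℕ) (m : ℕ) :
    ((bCount (stdAux d (m + 1)) * (stdAux d m).length : ℕ) : ℤ)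
      - (bCount (stdAux d m) * (stdAux d (m + 1)).length : ℕ) = (-1) ^ (m + 1) := by
  induction m with
  | zero => simp [stdAux, Letter.weight]
  | succ m ih =>
    rw [pow_succ, ← ih, stdAux]
    simp
    ring

lemma coprime_bCount_length_stdAux (d : ℕ → ℕ) (m : ℕ) :
    Nat.Coprime (bCount (stdAux d (m + 1))) (stdAux d (m + 1)).length := by
  rw [← Nat.isCoprime_iff_coprime]
  have h := stdAux_det d m
  push_cast at h
  refine ⟨(-1) ^ (m + 1) * (stdAux d m).length, -((-1) ^ (m + 1) * bCount (stdAux d m)), ?_⟩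
  have h2 : ((-1 : ℤ) ^ (m + 1)) * (-1) ^ (m + 1) = 1 := by
    rw [← mul_pow]; simp
  linear_combination ((-1 : ℤ) ^ (m + 1)) * h + h2

/-- The adjoining singular word `v_{m-1}`, as a word. -/
def adjWord (d : ℕ → ℕ) (m : ℕ) : List Letter :=
  lastLetter (m + 1) :: ((List.replicate (d (m + 1) - 1) (stdAux d (m + 1))).flatten ++ stem d m)

/-- The first letter of `adjWord` is the last letter of `stdAux d (m + 1)`, so it completes the stem
to the first of the `d (m + 1)` factors. -/
lemma stdAux_add_two_eq {d : ℕ → ℕ} (hd : ∀ i, 1 ≤ i → 1 ≤ d i) (m : ℕ) :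
    stdAux d (m + 2) = stem d (m + 1) ++ adjWord d m ++ [lastLetter m] := by
  obtain ⟨e, he⟩ := Nat.exists_eq_add_of_le' (hd (m + 1) (by omega))
  rw [stdAux, adjWord, he, List.replicate_succ, List.flatten_cons, Nat.add_sub_cancel]
  conv_lhs => rw [stdAux_eq d m]; lhs; lhs; rw [stdAux_eq]
  simp

lemma stem_add_two {d : ℕ → ℕ} (hd : ∀ i, 1 ≤ i → 1 ≤ d i) (m : ℕ) :
    stem d (m + 2) = stem d (m + 1) ++ adjWord d m := by
  rw [stem, stdAux_add_two_eq hd, List.dropLast_concat]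

lemma stdAux_prefix {d : ℕ → ℕ} (hd : ∀ i, 1 ≤ i → 1 ≤ d i) (m : ℕ) :
    stdAux d (m + 1) <+: stdAux d (m + 2) := by
  obtain ⟨e, he⟩ := Nat.exists_eq_add_of_le' (hd (m + 1) (by omega))
  rw [stdAux, he, List.replicate_succ, List.flatten_cons, List.append_assoc]
  exact List.prefix_append _ _

lemma std_natCast_sub_one (d : ℕ → ℕ) (m : ℕ) : std d ((m : ℤ) - 1) = stdAux d m := by
  simp [std]

lemma odd_natCast_sub_one (m : ℕ) : Odd ((m : ℤ) - 1) ↔ Even m := by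
  rw [Int.odd_sub]
  simp

/-- Both parities at once: the last letter is removed and the other letter is put in front. -/
lemma sing_natCast_sub_one (d : ℕ → ℕ) (m : ℕ) : sing d ((m : ℤ) - 1) =
    FreeGroup.of (lastLetter (m + 1)) * ofWord (stdAux d m)
      * (FreeGroup.of (lastLetter m))⁻¹ := by
  rw [sing, if_neg (by omega), std_natCast_sub_one]
  by_cases h : Even m
  · rw [if_pos ((odd_natCast_sub_one m).2 h)]
    simp [lastLetter, h, Nat.even_add_one]
  · rw [if_neg (mt (odd_natCast_sub_one m).1 h)]
    simp [lastLetter, h, Nat.even_add_one]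

lemma adj_natCast_sub_one {d : ℕ → ℕ} (hd : ∀ i, 1 ≤ i → 1 ≤ d i) (m : ℕ) :
    adj d ((m : ℤ) - 1) = ofWord (adjWord d m) := by
  obtain ⟨e, he⟩ := Nat.exists_eq_add_of_le' (hd (m + 1) (by omega))
  have h1 : std d ((m : ℤ) - 1 + 1) = stdAux d (m + 1) := by
    rw [← std_natCast_sub_one]; push_cast; congr 1; ring
  have h2 : ((m : ℤ) - 1 + 2).toNat = m + 1 := by omega
  have h3 : ((d (m + 1) : ℕ) : ℤ) - 1 = (e : ℕ) := by rw [he]; push_cast; ring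
  rw [adj, if_neg (by omega), std_natCast_sub_one, h1, h2, h3, zpow_natCast, adjWord, he,
    Nat.add_sub_cancel, ofWord_cons, ofWord_append, ofWord_flatten_replicate, ofWord_stem]
  by_cases h : Even m
  · rw [if_pos ((odd_natCast_sub_one m).2 h)]
    simp [lastLetter, h, Nat.even_add_one, mul_assoc]
  · rw [if_neg (mt (odd_natCast_sub_one m).1 h)]
    simp [lastLetter, h, Nat.even_add_one, mul_assoc]

/-- The product telescopes by `stem_add_two`, starting from the empty stem of `s₀ = a`. -/
lemma adjProd_natCast_sub_two {d : ℕ → ℕ} (hd : ∀ i, 1 ≤ i → 1 ≤ d i) (m : ℕ) :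
    adjProd d ((m : ℤ) - 2) = ofWord (stem d (m + 1)) := by
  have h : ((m : ℤ) - 2 + 2).toNat = m := by simp
  simp only [adjProd, h, List.bind_eq_flatMap, List.pure_def, ← List.map_eq_flatMap, List.map_map]
  clear h
  induction m with
  | zero => simp [stem, stdAux]
  | succ m ih =>
    rw [List.range_succ, List.map_append, List.prod_append, ih, stem_add_two hd,
      ofWord_append]
    simp [adj_natCast_sub_one hd]

/-! ### Return words of the conjugates of a standard word -/

section

variable {d : ℕ → ℕ}

/-- The index starts at `N + 2` because `s₋₁ = b` is not a prefix of `s₀ = a`. -/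
lemma occursAt_rotate_stdAux_iff (hd : ∀ i, 1 ≤ i → 1 ≤ d i) (N : ℕ) {k : ℕ}
    (hk : k < (stdAux d (N + 2)).length) (m : ℕ) :
    OccursAt (charWord (cfValue (quotients d))) ((stdAux d (N + 2)).rotate k) m ↔
      ∃ i, m = blockStart (letterSubst (stdAux d (N + 2)) (stdAux d (N + 1)))
          (charWord (tailValue d (N + 1) / (1 + tailValue d (N + 1)))) i + k ∧
        (charWord (tailValue d (N + 1) / (1 + tailValue d (N + 1))) i = Letter.a ∨
          k + 2 ≤ (stdAux d (N + 1)).length) := by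
  obtain ⟨P, h1, h2⟩ := stdAux_almost_commute d (N + 1)
  have hX := isImage_stdAux hd (N + 1)
  rw [← cfValue_quotients hd] at hX
  exact occursAt_rotate_iff hX (fun i => (isImage_charWord_tail hd (N + 1)).succ_eq_a) h1 h2
    (lastLetter_succ_ne _) (stdAux_prefix hd N) (stdAux_ne_nil _ _)
    (coprime_bCount_length_stdAux d (N + 1)) hk m

lemma occursAt_take_stdAux (hd : ∀ i, 1 ≤ i → 1 ≤ d i) (N : ℕ) {k : ℕ}
    (hk : k < (stdAux d (N + 2)).length) {i : ℕ}
    (hi : charWord (tailValue d (N + 1) / (1 + tailValue d (N + 1))) i = Letter.a ∨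
          k + 2 ≤ (stdAux d (N + 1)).length) :
    OccursAt (charWord (cfValue (quotients d))) ((stdAux d (N + 2)).take k)
      (blockStart (letterSubst (stdAux d (N + 2)) (stdAux d (N + 1)))
          (charWord (tailValue d (N + 1) / (1 + tailValue d (N + 1)))) i) := by
  obtain ⟨P, h1, h2⟩ := stdAux_almost_commute d (N + 1)
  have hX := isImage_stdAux hd (N + 1)
  rw [← cfValue_quotients hd] at hX
  exact occursAt_take hX (fun i => (isImage_charWord_tail hd (N + 1)).succ_eq_a) h1 h2
    (stdAux_prefix hd N) (stdAux_ne_nil _ _) hk hi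

lemma length_stdAux_lt (hd : ∀ i, 1 ≤ i → 1 ≤ d i) (m : ℕ) :
    (stdAux d (m + 1)).length < (stdAux d (m + 2)).length := by
  obtain ⟨e, he⟩ := Nat.exists_eq_add_of_le' (hd (m + 1) (by omega))
  have := List.length_pos_iff.2 (stdAux_ne_nil d m)
  rw [stdAux, he, List.replicate_succ]
  simp
  omega

lemma take_stem_eq {m k : ℕ} (hk : k + 1 ≤ (stdAux d m).length) :
    (stem d m).take k = (stdAux d m).take k := by
  rw [stem, List.dropLast_eq_take, List.take_take, min_eq_left (by omega)]

lemma take_stdAux_succ (hd : ∀ i, 1 ≤ i → 1 ≤ d i) {m k : ℕ}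
    (hk : k ≤ (stdAux d (m + 1)).length) :
    (stdAux d (m + 2)).take k = (stdAux d (m + 1)).take k := by
  obtain ⟨r, hr⟩ := stdAux_prefix hd m
  rw [← hr, List.take_append_of_le_length hk]

/-- The occurrences of the conjugates `C_k(sₙ)` with `k + 2 ≤ qₙ₋₁`, for `n = M + 2`. -/
theorem occurrences_short (hd : ∀ i, 1 ≤ i → 1 ≤ d i) (M k : ℕ)
    (hk : k + 2 ≤ (stdAux d (M + 2)).length) :
    ∃ u v : List Letter,
      ofWord (v ++ u) = sing d (((M + 2 : ℕ) : ℤ) - 1) ∧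
      v.length = k + 1 ∧
      ofWord ((stdAux d (M + 3)).rotate k) =
        ofWord u * adj d (((M + 1 : ℕ) : ℤ) - 1) * ofWord v ∧
      (∃ t : List Letter, t ≠ [] ∧ ofWord t =
        ofWord u * bigU d ((M + 1 : ℕ) : ℤ) ((d (M + 2) : ℤ) - 2) * ofWord v) ∧
      IsOccurrenceDecomposition (charWord (cfValue (quotients d))) ((stdAux d (M + 3)).rotate k)
        (adjProd d (((M + 1 : ℕ) : ℤ) - 2) * (ofWord u)⁻¹)
        (overAlphabet (charWord (cfTail (quotients d) (M + 2) 1)) 1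
          (ofWord u * bigU d ((M + 1 : ℕ) : ℤ) ((d (M + 2) : ℤ) - 2) * ofWord v)⁻¹) := by
  have hlt : (stdAux d (M + 2)).length < (stdAux d (M + 3)).length := length_stdAux_lt hd (M + 1)
  have hks : k < (stdAux d (M + 3)).length := by omega
  set x := (stem d (M + 2)).take k with hx
  set u := (stem d (M + 2)).drop k with hu
  have hxu : x ++ u = stem d (M + 2) := List.take_append_drop _ _
  have hxt : x = (stdAux d (M + 2)).take k := take_stem_eq (by omega)
  have hxs : x = (stdAux d (M + 3)).take k := by
    rw [hxt, take_stdAux_succ hd (m := M + 1) (show k ≤ (stdAux d (M + 2)).length by omega)]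
  have hxlen : x.length = k := by rw [hxt, List.length_take]; omega
  have hxu' : ofWord u = (ofWord x)⁻¹ * ofWord (stem d (M + 2)) := by
    rw [← hxu, ofWord_append]; group
  have hrot : (stdAux d (M + 3)).rotate k = u ++ adjWord d (M + 1) ++ (lastLetter (M + 1) :: x) := by
    have h := stdAux_add_two_eq hd (M + 1)
    rw [← hxu] at h
    rw [h, show x ++ u ++ adjWord d (M + 1) ++ [lastLetter (M + 1)]
      = x ++ (u ++ adjWord d (M + 1) ++ [lastLetter (M + 1)]) by simp]
    conv_lhs => rw [← hxlen]
    rw [List.rotate_append_length_eq]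
    simp
  have hU : ofWord u * bigU d ((M + 1 : ℕ) : ℤ) ((d (M + 2) : ℤ) - 2)
      * ofWord (lastLetter (M + 1) :: x) = (ofWord x)⁻¹ * (ofWord (stdAux d (M + 2)))⁻¹ *
        ofWord (stdAux d (M + 3)) * ofWord x := by
    have e1 : ((M + 1 : ℕ) : ℤ) - 2 = ((M : ℕ) : ℤ) - 1 := by push_cast; ring
    have e2 : ofWord (adjWord d M) = (ofWord (stem d (M + 1)))⁻¹ * ofWord (stdAux d (M + 2))
        * (FreeGroup.of (lastLetter M))⁻¹ := by
      rw [stdAux_add_two_eq hd M]; simp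
    -- The product `wₙ₋₂ vₙ₋₃` is `sₙ₋₁` conjugated by one letter, so its powers, including the
    -- exponent `-1` for `dₙ = 1`, are conjugated powers of `sₙ₋₁`.
    have e3 : FreeGroup.of (lastLetter M) * ofWord (stdAux d (M + 1)) *
        (FreeGroup.of (lastLetter (M + 1)))⁻¹ * ofWord (adjWord d M) =
        FreeGroup.of (lastLetter M) * ofWord (stdAux d (M + 2))
          * (FreeGroup.of (lastLetter M))⁻¹ := by
      rw [e2, ofWord_stem]; group
    rw [bigU, e1, sing_natCast_sub_one, adj_natCast_sub_one hd,
      show M + 1 + 1 = M + 2 from rfl, lastLetter_add_two, e3, conj_zpow, hxu', ofWord_stem,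
      lastLetter_add_two, ofWord_cons, ofWord_stdAux d (M + 1), ← zpow_natCast]
    generalize ofWord (stdAux d (M + 2)) = t
    generalize ofWord (stdAux d (M + 1)) = r
    group
  refine ⟨u, lastLetter (M + 1) :: x, ?_, ?_, ?_, ?_, ?_⟩
  · rw [List.cons_append, hxu, ofWord_cons, ofWord_stem, sing_natCast_sub_one, ← mul_assoc,
      lastLetter_add_two]
    simp only [lastLetter_add_two]
  · simp [hxlen]
  · rw [adj_natCast_sub_one hd, hrot, ofWord_append, ofWord_append]
  -- Both sides are prefixes of `sₙ₋₁ sₙ`. The word sought is what `sₙ x` has beyond `sₙ₋₁ x`,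
  -- non-empty because `sₙ` is longer than `sₙ₋₁`.
  · have hpre : stdAux d (M + 2) ++ x <+: stdAux d (M + 3) ++ x := by
      obtain ⟨P, h1, h2⟩ := stdAux_almost_commute d (M + 2)
      have hsP : stdAux d (M + 3) ++ x <+: P := by
        rw [hxs]
        exact append_take_prefix_of_almost_commute h1 (stdAux_prefix hd _) hk
      have hPts : P <+: stdAux d (M + 2) ++ stdAux d (M + 3) := h2 ▸ List.prefix_append _ _
      have hts : stdAux d (M + 2) ++ x <+: stdAux d (M + 2) ++ stdAux d (M + 3) := by
        rw [List.prefix_append_right_inj, hxs]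
        exact List.take_prefix _ _
      exact List.prefix_of_prefix_length_le hts (hsP.trans hPts) (by simp; omega)
    obtain ⟨e, he⟩ := hpre
    refine ⟨e, ?_, ?_⟩
    · rintro rfl
      have := congrArg List.length he
      simp at this
      omega
    · have := congrArg ofWord he
      simp only [ofWord_append] at this
      rw [hU, mul_assoc _ (ofWord (stdAux d (M + 3))), ← this]
      group
  · rw [cfTail_quotients_one hd (by omega), hU]
    have hX := isImage_stdAux hd (M + 2)
    rw [← cfValue_quotients hd] at hX
    refine hX.isOccurrenceDecomposition (h := x)
      (letterSubst_ne_nil (stdAux_ne_nil _ _) (stdAux_ne_nil _ _)) (fun i => ?_) (fun m => ?_) ?_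
      (fun i => ?_)
    · rw [hxs]
      exact occursAt_take_stdAux hd (M + 1) hks (Or.inr hk)
    · rw [occursAt_rotate_stdAux_iff hd (M + 1) hks, hxlen]
      simp only [hk, or_true, and_true]
    · rw [adjProd_natCast_sub_two hd, show M + 1 + 1 = M + 2 from rfl, ← hxu, ofWord_append]
      group
    · rw [ofWord_rotate hks.le, ← hxs, overAlphabet]
      cases charWord (tailValue d (M + 2) / (1 + tailValue d (M + 2))) i
      · simp [letterSubst]
      · simp only [letterSubst]
        group

/-- The occurrences of the conjugates `C_k(sₙ)` with `qₙ₋₁ ≤ k + 1 ≤ qₙ`, for `n = N + 1`. -/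
theorem occurrences_long (hd : ∀ i, 1 ≤ i → 1 ≤ d i) (N k : ℕ)
    (hk1 : (stdAux d (N + 1)).length ≤ k + 1) (hk2 : k + 1 ≤ (stdAux d (N + 2)).length) :
    ∃ u v : List Letter,
      ofWord (v ++ u) = adj d ((N : ℤ) - 1) ∧
      v.length + (stdAux d (N + 1)).length = k + 1 ∧
      ofWord ((stdAux d (N + 2)).rotate k) =
        ofWord u * sing d (((N + 1 : ℕ) : ℤ) - 1) * ofWord v ∧
      (∃ t : List Letter, ofWord t =
        (ofWord v)⁻¹ * sing d (((N + 2 : ℕ) : ℤ) - 1) * (ofWord u)⁻¹) ∧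
      IsOccurrenceDecomposition (charWord (cfValue (quotients d))) ((stdAux d (N + 2)).rotate k)
        (adjProd d (((N + 1 : ℕ) : ℤ) - 2) * (ofWord u)⁻¹)
        (overAlphabet (charWord (cfTail (quotients d) (N + 1) 0)) 1
          ((ofWord v)⁻¹ * sing d (((N + 2 : ℕ) : ℤ) - 1) * (ofWord u)⁻¹)) := by
  have hks : k < (stdAux d (N + 2)).length := by omega
  have hdec := stdAux_add_two_eq hd N
  have hTlen : (stem d (N + 1)).length + 1 = (stdAux d (N + 1)).length := by
    simp [stdAux_eq d (N + 1)]
  have hVlen := congrArg List.length hdec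
  simp only [List.length_append, List.length_singleton] at hVlen
  -- The cut at `k` lies beyond the stem of `sₙ₋₁`, hence inside `vₙ₋₂`, at distance `j` from its
  -- start.
  obtain ⟨j, rfl⟩ := Nat.exists_eq_add_of_le (show (stem d (N + 1)).length ≤ k by omega)
  set v := (adjWord d N).take j with hv
  set u := (adjWord d N).drop j with hu
  have hvu : v ++ u = adjWord d N := List.take_append_drop _ _
  have hvlen : v.length = j := by rw [hv, List.length_take]; omega
  have hdec' : stdAux d (N + 2) = (stem d (N + 1) ++ v) ++ (u ++ [lastLetter N]) := by
    rw [hdec, ← hvu]; simp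
  have hxlen : (stem d (N + 1) ++ v).length = (stem d (N + 1)).length + j := by simp [hvlen]
  set k := (stem d (N + 1)).length + j with hkdef
  set x := stem d (N + 1) ++ v with hx
  have hxs : x = (stdAux d (N + 2)).take k := by
    rw [hdec', ← hxlen, List.take_left']
    rfl
  have hrot : (stdAux d (N + 2)).rotate k =
      u ++ (lastLetter N :: stem d (N + 1)) ++ v := by
    rw [hdec', ← hxlen, List.rotate_append_length_eq, hx]
    simp
  have hW : (ofWord v)⁻¹ * sing d (((N + 2 : ℕ) : ℤ) - 1) * (ofWord u)⁻¹ =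
      (ofWord x)⁻¹ * ofWord (stdAux d (N + 1)) * ofWord x := by
    have e1 := congrArg ofWord hdec'
    have e2 := congrArg ofWord hx
    simp only [ofWord_append, ofWord_singleton, ofWord_stem] at e1 e2
    rw [sing_natCast_sub_one, e1, lastLetter_add_two, lastLetter_add_two, e2]
    group
  refine ⟨u, v, ?_, ?_, ?_, ?_, ?_⟩
  · rw [hvu, adj_natCast_sub_one hd]
  · omega
  · rw [hrot, sing_natCast_sub_one, ofWord_append, ofWord_append, ofWord_cons, ofWord_stem,
      ← mul_assoc (FreeGroup.of (lastLetter N)), show N + 1 + 1 = N + 2 from rfl,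
      lastLetter_add_two]
  · rw [hW]
    -- Both sides are prefixes of `sₙ₋₁ sₙ`; the remainder `e` satisfies `x e = sₙ₋₁ x`.
    have hpre : x <+: stdAux d (N + 1) ++ x := by
      obtain ⟨P, h1, h2⟩ := stdAux_almost_commute d (N + 1)
      have hxP : x <+: P := by
        rw [hxs]
        exact take_prefix_of_almost_commute h1 (stdAux_ne_nil _ _) hks
      have hPts : P <+: stdAux d (N + 1) ++ stdAux d (N + 2) := h2 ▸ List.prefix_append _ _
      have hts : stdAux d (N + 1) ++ x <+: stdAux d (N + 1) ++ stdAux d (N + 2) := by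
        rw [List.prefix_append_right_inj, hxs]
        exact List.take_prefix _ _
      exact List.prefix_of_prefix_length_le (hxP.trans hPts) hts (by simp)
    obtain ⟨e, he⟩ := hpre
    refine ⟨e, ?_⟩
    have := congrArg ofWord he
    simp only [ofWord_append] at this
    rw [mul_assoc, ← this]
    group
  · rw [cfTail_quotients_zero (by omega), hW]
    have hX := isImage_stdAux hd (N + 1)
    rw [← cfValue_quotients hd] at hX
    have hφ := isImage_charWord_tail hd (N + 1)
    have hstart := blockStart_flatMap (S := letterSubst (stdAux d (N + 2)) (stdAux d (N + 1))) hφ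
    refine (hX.comp hφ).isOccurrenceDecomposition (h := x)
      (fun l => ?_) (fun i => ?_) (fun m => ?_) ?_ (fun i => ?_)
    · cases l <;> simp [letterSubst, stdAux_ne_nil]
    · rw [hxs, hstart]
      exact occursAt_take_stdAux hd N hks (Or.inl (hφ.apply_blockStart i))
    -- Only blocks coded by `a` remain, and the positions of `a` are the block starts of the coarser
    -- coding.
    · have hk3 : ¬ k + 2 ≤ (stdAux d (N + 1)).length := by omega
      rw [occursAt_rotate_stdAux_iff hd N hks, hxlen]
      simp only [hk3, or_false, hφ.eq_a_iff, hstart]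
      constructor
      · rintro ⟨_, rfl, j, rfl⟩
        exact ⟨j, rfl⟩
      · rintro ⟨j, rfl⟩
        exact ⟨_, rfl, j, rfl⟩
    · rw [adjProd_natCast_sub_two hd, stem_add_two hd, ← hvu, ← List.append_assoc, ← hx,
        ofWord_append]
      group
    · rw [ofWord_rotate hks.le, ← hxs, overAlphabet]
      cases charWord (tailValue d (N + 1)) i
      · simp [letterSubst]
      · simp only [letterSubst, List.flatMap_cons, List.flatMap_nil, List.append_nil,
          ofWord_append]
        group

end

end Sturmian

theorem mainTheorem3 (d : ℕ → ℕ) (hd : ∀ i, 1 ≤ i → 1 ≤ d i)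
    (α : ℝ) (hα : α = cfValue (quotients d)) (n : ℕ) (hn : 1 ≤ n)
    (k : ℕ) (w : List Letter) (hw : w = (std d n).rotate k) :
    (k + 2 ≤ cfDen (quotients d) (n - 1) →
      ∃ u v : List Letter,
        ofWord (v ++ u) = sing d ((n : ℤ) - 1) ∧
        v.length = k + 1 ∧
        ofWord w = ofWord u * adj d ((n : ℤ) - 2) * ofWord v ∧
        (∃ t : List Letter, t ≠ [] ∧
          ofWord t = ofWord u * bigU d ((n : ℤ) - 1) ((d n : ℤ) - 2) * ofWord v) ∧
        IsOccurrenceDecomposition (charWord α) w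
          (adjProd d ((n : ℤ) - 3) * (ofWord u)⁻¹)
          (overAlphabet (charWord (cfTail (quotients d) n 1)) 1
            (ofWord u * bigU d ((n : ℤ) - 1) ((d n : ℤ) - 2) * ofWord v)⁻¹)) ∧
    (cfDen (quotients d) (n - 1) ≤ k + 1 → k + 1 ≤ cfDen (quotients d) n →
      ∃ u v : List Letter,
        ofWord (v ++ u) = adj d ((n : ℤ) - 2) ∧
        v.length + cfDen (quotients d) (n - 1) = k + 1 ∧
        ofWord w = ofWord u * sing d ((n : ℤ) - 1) * ofWord v ∧
        (∃ t : List Letter, ofWord t = (ofWord v)⁻¹ * sing d n * (ofWord u)⁻¹) ∧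
        IsOccurrenceDecomposition (charWord α) w
          (adjProd d ((n : ℤ) - 2) * (ofWord u)⁻¹)
          (overAlphabet (charWord (cfTail (quotients d) n 0)) 1
            ((ofWord v)⁻¹ * sing d n * (ofWord u)⁻¹))) := by
  obtain ⟨N, rfl⟩ := Nat.exists_eq_add_of_le' hn
  have hstd : std d ((N + 1 : ℕ) : ℤ) = stdAux d (N + 2) := by
    rw [← std_natCast_sub_one]; push_cast; congr 1; ring
  rw [hstd] at hw
  rw [hα, hw, Nat.add_sub_cancel, ← length_stdAux, ← length_stdAux]
  have e1 : ((N + 1 : ℕ) : ℤ) - 2 = (N : ℤ) - 1 := by push_cast; ring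
  have e2 : ((N + 1 : ℕ) : ℤ) = ((N + 2 : ℕ) : ℤ) - 1 := by push_cast; ring
  constructor
  · intro hk
    -- For `n = 1` the first case is empty, since `q₀ = 1`.
    obtain _ | M := N
    · simp [stdAux] at hk
    have e3 : ((M + 1 + 1 : ℕ) : ℤ) - 1 = ((M + 1 : ℕ) : ℤ) := by push_cast; ring
    have e4 : ((M + 1 + 1 : ℕ) : ℤ) - 3 = ((M + 1 : ℕ) : ℤ) - 2 := by push_cast; ring
    have h := occurrences_short hd M k hk
    rw [show M + 2 = M + 1 + 1 from rfl, e3] at h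
    rw [e4, e1, e3]
    exact h
  · intro hk1 hk2
    have h := occurrences_long hd N k hk1 hk2
    rw [← e2, e1] at h
    rw [e1]
    exact h
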